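/- A stub graph $G$ is a finite simple graph $G^-$ with a nonempty vertex set, together with finitely many stubs, each incident with exactly one vertex and labelled by a positive integer (its index). The degree $\deg_G v$ is the number of edges and stubs incident with $v$, and $G$ is $k$-edge-connected if $G^-$ is, that is, if no removal of fewer than $k$ edges disconnects $G^-$. A spanning tree of $G$ is a spanning tree of $G^-$. For every real $\varepsilon$ with $0<\varepsilon<4$ and every integer $m\ge 0$ there exists $L$ such that every $2^n$-edge-connected stub graph $G$ with minimum degree at least $L$, where $n=2+m+\lceil\log_2(1/\varepsilon)\rceil$, has $2^m$ pairwise edge-disjoint spanning trees $T_1,\ldots,T_{2^m}$ such that \[\sum_{i=1}^{2^m}\deg_{T_i} v\le \varepsilon\,\deg_G v\] for every vertex $v$ of $G$. -/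

import Mathlib

/-- A stub graph on the vertex set `V` whose set of stubs is `S`: a simple graph together with
stubs (hyperedges of size one), each incident with a single vertex and carrying a positive
integer, its index. -/
structure StubGraph (V S : Type*) where
  /-- The graph obtained by removing all the stubs. -/
  minus : SimpleGraph V
  /-- The vertex with which a stub is incident. -/
  stubVertex : S → V
  /-- The index of a stub. -/
  index : S → ℕ+

namespace StubGraph

variable {V S : Type*}

open Classical in
/-- The degree of a vertex: the number of edges and stubs incident with it. -/
noncomputable def degree [Fintype V] [Fintype S] (G : StubGraph V S) (v : V) : ℕ :=
  G.minus.degree v + Fintype.card {s : S // G.stubVertex s = v}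

/-- A stub graph is `k`-edge-connected if the graph obtained by removing its stubs is
`k`-edge-connected: no removal of fewer than `k` edges disconnects it. -/
def IsEdgeConnected (G : StubGraph V S) (k : ℕ) : Prop :=
  G.minus.IsEdgeConnected k

/-- A spanning tree of a stub graph: a tree (without stubs) on the whole vertex set, all of whose
edges are edges of the stub graph. -/
structure IsSpanningTree (G : StubGraph V S) (T : SimpleGraph V) : Prop where
  le_minus : T ≤ G.minus
  isTree : T.IsTree

end StubGraph

/-! Put `k = 2 ^ (m + j)` and `N = 2 ^ m`, where `j = 1 + ⌈log₂ (1/ε)⌉`. A `2k`-edge-connected graph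
has `k` disjoint spanning trees (Nash-Williams, Tutte). Their union `E` can be oriented with all
in-degrees at most `k`. Colour every edge of `E` by its tail. Weight `N / k` on each edge of `E` is
a fractional packing of `N` spanning trees that uses at most `N * deg v / k` of colour `v`. Matroid
intersection, between `N` copies of the graphic matroid and a matroid bounding the colours, makes
this integral at the cost of rounding up. The `N` trees then have total degree at most `N * deg v /
k + 1` from outgoing edges and `k` from incoming ones. As `N / k ≤ ε / 2`, a large minimum degree
absorbs `1 + k`. Both packings come from `exists_disjoint_bases`. -/

/-! ### Matroid rank functions and matroid intersection -/

/-- A matroid rank function on the finite subsets of a type. -/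
structure IsRankFunction {α : Type*} [DecidableEq α] (r : Finset α → ℕ) : Prop where
  empty : r ∅ = 0
  mono : ∀ A B, A ⊆ B → r A ≤ r B
  insert_le : ∀ e A, r (insert e A) ≤ r A + 1
  submodular : ∀ A B, r (A ∪ B) + r (A ∩ B) ≤ r A + r B

namespace IsRankFunction

variable {α : Type*} [DecidableEq α] {r : Finset α → ℕ}

theorem le_card (h : IsRankFunction r) (A : Finset α) : r A ≤ A.card := by
  induction A using Finset.induction_on with
  | empty => simp [h.empty]
  | insert e A he ih =>
    rw [Finset.card_insert_of_notMem he]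
    exact (h.insert_le e A).trans (by omega)

theorem union_le (h : IsRankFunction r) (A B : Finset α) : r (A ∪ B) ≤ r A + B.card := by
  have h1 := h.submodular A B
  have h2 := h.le_card B
  omega

theorem eq_card_of_subset (h : IsRankFunction r) {A B : Finset α} (hAB : A ⊆ B)
    (hB : r B = B.card) : r A = A.card := by
  have h1 := h.union_le A (B \ A)
  have h2 := h.le_card A
  rw [Finset.union_sdiff_of_subset hAB] at h1
  have h3 := Finset.card_sdiff_add_card_eq_card hAB
  omega

/-- The rank function of the contraction of a non-loop. -/
theorem contract (h : IsRankFunction r) {e : α} (he : r {e} = 1) :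
    IsRankFunction fun A => r (insert e A) - 1 := by
  have pos : ∀ A, 1 ≤ r (insert e A) := fun A =>
    he ▸ h.mono _ _ (by simp)
  refine ⟨by simp [he], fun A B hAB => ?_, fun x A => ?_, fun A B => ?_⟩
  · have := h.mono _ _ (Finset.insert_subset_insert e hAB)
    omega
  · have := h.insert_le x (insert e A)
    rw [Finset.insert_comm] at this
    have := pos A
    omega
  · have := h.submodular (insert e A) (insert e B)
    rw [← Finset.insert_inter_distrib, ← Finset.insert_union_distrib] at this
    have := pos A
    have := pos B
    have := pos (A ∩ B)
    have := pos (A ∪ B)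
    omega

/-- Edmonds' matroid intersection theorem. -/
theorem exists_common_independent {r₁ r₂ : Finset α → ℕ} (h₁ : IsRankFunction r₁)
    (h₂ : IsRankFunction r₂) (X : Finset α) (k : ℕ)
    (hk : ∀ A ⊆ X, k ≤ r₁ A + r₂ (X \ A)) :
    ∃ I ⊆ X, I.card = k ∧ r₁ I = k ∧ r₂ I = k := by
  induction X using Finset.induction_on generalizing r₁ r₂ k with
  | empty =>
    have := hk ∅ (by simp)
    simp only [Finset.sdiff_self, h₁.empty, h₂.empty] at this
    exact ⟨∅, by simp, by simp; omega, by rw [h₁.empty]; omega, by rw [h₂.empty]; omega⟩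
  | insert e X he ih =>
    by_cases hX : ∀ A ⊆ X, k ≤ r₁ A + r₂ (X \ A)
    · obtain ⟨I, hI, h⟩ := ih h₁ h₂ k hX
      exact ⟨I, hI.trans (Finset.subset_insert _ _), h⟩
    -- Deleting `e` fails, with witness `A`; then `e` is a loop in neither matroid and contracting
    -- it works.
    push Not at hX
    obtain ⟨A, hA, hAk⟩ := hX
    have keyOut : ∀ B ⊆ X, k ≤ r₁ B + r₂ (insert e (X \ B)) := fun B hB => by
      have := hk B (hB.trans (Finset.subset_insert _ _))
      rwa [Finset.insert_sdiff_of_notMem _ (fun h => he (hB h))] at this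
    have keyIn : ∀ B ⊆ X, k ≤ r₁ (insert e B) + r₂ (X \ B) := fun B hB => by
      have := hk (insert e B) (Finset.insert_subset_insert _ hB)
      rwa [Finset.insert_sdiff_insert, Finset.sdiff_insert_of_notMem he] at this
    have hloop₁ : r₁ {e} = 1 := by
      have h1 := keyIn A hA
      have h2 := h₁.submodular A {e}
      have h3 := h₁.le_card {e}
      rw [Finset.union_comm, ← Finset.insert_eq] at h2
      simp at h3
      omega
    have hloop₂ : r₂ {e} = 1 := by
      have h1 := keyOut A hA
      have h2 := h₂.submodular (X \ A) {e}
      have h3 := h₂.le_card {e}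
      rw [Finset.union_comm, ← Finset.insert_eq] at h2
      simp at h3
      omega
    -- Uncrossing: a violating `B` for the contraction, together with `A`, would give rank sums of
    -- at most `2k - 1`, but submodularity and the hypothesis at `A ∪ B + e` and `A ∩ B` give at
    -- least `2k`.
    obtain ⟨I, hI, hc, hr₁, hr₂⟩ := ih (h₁.contract hloop₁) (h₂.contract hloop₂) (k - 1) (by
      intro B hB
      have hAB : X \ A ∪ X \ B = X \ (A ∩ B) := sdiff_inf.symm
      have s₁ := h₁.submodular A (insert e B)
      have s₂ := h₂.submodular (X \ A) (insert e (X \ B))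
      have k₁ := keyIn (A ∪ B) (Finset.union_subset hA hB)
      have k₂ := keyOut (A ∩ B) (Finset.inter_subset_left.trans hA)
      rw [Finset.union_insert, Finset.inter_insert_of_notMem (fun h => he (hA h))] at s₁
      rw [Finset.union_insert, Finset.inter_insert_of_notMem (by simp [he]),
        ← Finset.sdiff_union_distrib, hAB] at s₂
      omega)
    have p₁ : 1 ≤ r₁ (insert e I) := hloop₁ ▸ h₁.mono _ _ (by simp)
    have p₂ : 1 ≤ r₂ (insert e I) := hloop₂ ▸ h₂.mono _ _ (by simp)
    refine ⟨insert e I, Finset.insert_subset_insert _ hI, ?_, ?_, ?_⟩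
    · rw [Finset.card_insert_of_notMem (fun h => he (hI h)), hc]
      omega
    · omega
    · omega

end IsRankFunction

/-! ### Direct sums and packing of bases under colour bounds -/

/-- The elements of a subset of a product lying above a given index. -/
def slice {ι α : Type*} [DecidableEq ι] [DecidableEq α] (A : Finset (ι × α)) (i : ι) : Finset α :=
  (A.filter fun p => p.1 = i).image Prod.snd

section slice

variable {ι α : Type*} [DecidableEq ι] [DecidableEq α]

@[simp]
theorem mem_slice {A : Finset (ι × α)} {i : ι} {a : α} : a ∈ slice A i ↔ (i, a) ∈ A := by
  simp [slice]

theorem sum_card_filter_slice [Fintype ι] (A : Finset (ι × α)) (p : α → Prop) [DecidablePred p] :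
    ∑ i, ((slice A i).filter p).card = (A.filter fun x => p x.2).card := by
  rw [Finset.card_eq_sum_card_fiberwise (f := Prod.fst) (t := Finset.univ) (by simp)]
  refine Finset.sum_congr rfl fun i _ => ?_
  refine Finset.card_bij (fun a _ => (i, a)) ?_ ?_ ?_
  · simp +contextual
  · simp
  · rintro ⟨j, a⟩ h
    simp only [Finset.mem_filter] at h
    obtain ⟨⟨h1, h2⟩, rfl⟩ := h
    exact ⟨a, by simp [h1, h2], rfl⟩

end slice

namespace IsRankFunction

/-- The rank function of a direct sum of copies of a matroid. -/
theorem sum_slice {ι α : Type*} [DecidableEq ι] [DecidableEq α] [Fintype ι] {r : Finset α → ℕ}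
    (h : IsRankFunction r) : IsRankFunction fun A : Finset (ι × α) => ∑ i, r (slice A i) := by
  refine ⟨?_, fun A B hAB => ?_, ?_, fun A B => ?_⟩
  · simp [slice, h.empty]
  · refine Finset.sum_le_sum fun i _ => h.mono _ _ fun a ha => ?_
    rw [mem_slice] at *
    exact hAB ha
  · rintro ⟨i, a⟩ A
    have : ∑ j, r (slice (insert (i, a) A) j) ≤ ∑ j, (r (slice A j) + if j = i then 1 else 0) := by
      refine Finset.sum_le_sum fun j _ => ?_
      split_ifs with hj
      · subst hj
        rw [show slice (insert (j, a) A) j = insert a (slice A j) by ext; simp]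
        exact h.insert_le _ _
      · rw [show slice (insert (i, a) A) j = slice A j by ext; simp [hj]]
        simp
    simpa [Finset.sum_add_distrib] using this
  · simp only [← Finset.sum_add_distrib]
    refine Finset.sum_le_sum fun i _ => ?_
    rw [show slice (A ∪ B) i = slice A i ∪ slice B i by ext; simp,
      show slice (A ∩ B) i = slice A i ∩ slice B i by ext; simp]
    exact h.submodular _ _

/-- The rank function of the laminar matroid in which a set is independent if `f` is injective on
it and it contains at most `b x` elements of each colour `x`. -/
theorem sum_min_card_image {γ α β : Type*} [DecidableEq γ] [DecidableEq α] [DecidableEq β]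
    [Fintype β] (f : γ → α) (c : α → β) (b : β → ℕ) :
    IsRankFunction fun A : Finset γ =>
      ∑ x, min (b x) ((A.image f).filter fun a => c a = x).card := by
  have mono : ∀ (A B : Finset γ) (x : β), A ⊆ B → ((A.image f).filter fun a => c a = x).card ≤
      ((B.image f).filter fun a => c a = x).card := fun A B x h =>
    Finset.card_le_card (Finset.filter_subset_filter _ (Finset.image_subset_image h))
  refine ⟨by simp, fun A B hAB => ?_, fun e A => ?_, fun A B => ?_⟩
  · exact Finset.sum_le_sum fun x _ => min_le_min le_rfl (mono A B x hAB)
  · have : ∑ x, min (b x) (((insert e A).image f).filter fun a => c a = x).card ≤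
        ∑ x, (min (b x) ((A.image f).filter fun a => c a = x).card +
          if c (f e) = x then 1 else 0) := by
      refine Finset.sum_le_sum fun x _ => ?_
      rw [Finset.image_insert, Finset.filter_insert]
      split_ifs
      · have := Finset.card_insert_le (f e) ((A.image f).filter fun a => c a = x)
        omega
      · simp
    simpa [Finset.sum_add_distrib] using this
  · simp only [← Finset.sum_add_distrib]
    refine Finset.sum_le_sum fun x _ => ?_
    have h1 := mono (A ∩ B) A x Finset.inter_subset_left
    have h2 := mono (A ∩ B) B x Finset.inter_subset_right
    have h3 := Finset.card_union_add_card_inter ((A.image f).filter fun a => c a = x)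
      ((B.image f).filter fun a => c a = x)
    have h4 : (((A ∩ B).image f).filter fun a => c a = x).card ≤
        (((A.image f).filter fun a => c a = x) ∩ ((B.image f).filter fun a => c a = x)).card := by
      refine Finset.card_le_card ?_
      rw [← Finset.filter_inter_distrib]
      exact Finset.filter_subset_filter _ (Finset.image_inter_subset _ _ _)
    rw [← Finset.filter_union, ← Finset.image_union] at h3
    omega

/-- Disjoint bases that together contain at most `b x` elements of each colour `x`. -/
theorem exists_disjoint_bases {α β : Type*} [DecidableEq α] [DecidableEq β] [Fintype β]
    {r : Finset α → ℕ} (h : IsRankFunction r) (E : Finset α) (c : α → β) (b : β → ℕ) (N ρ : ℕ)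
    (hρ : ∀ A, r A ≤ ρ)
    (hE : ∀ A ⊆ E, N * ρ ≤ N * r A + ∑ x, min (b x) ((E \ A).filter fun e => c e = x).card) :
    ∃ F : Fin N → Finset α, (∀ i, F i ⊆ E) ∧ (∀ i j, i ≠ j → Disjoint (F i) (F j)) ∧
      (∀ i, (F i).card = ρ ∧ r (F i) = ρ) ∧
      ∀ x, ∑ i, ((F i).filter fun e => c e = x).card ≤ b x := by
  obtain ⟨I, hI, hcard, h₁, h₂⟩ := exists_common_independent (h.sum_slice (ι := Fin N))
    (sum_min_card_image (γ := Fin N × α) Prod.snd c b) (Finset.univ ×ˢ E) (N * ρ) (by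
      intro A hA
      rcases Nat.eq_zero_or_pos N with rfl | hN
      · simp
      set S := ∑ x, min (b x) ((((Finset.univ ×ˢ E) \ A).image Prod.snd).filter
        fun a => c a = x).card
      -- An element missing from one slice already lies in the projection of the complement, so
      -- every slice satisfies the bound with the same `S`; the average over `i` is the intersection
      -- condition.
      have key : ∀ i, N * ρ ≤ N * r (slice A i) + S := fun i => by
        refine (hE (slice A i) fun a ha => ?_).trans ?_
        · simpa using hA (mem_slice.1 ha)
        · refine Nat.add_le_add_left (Finset.sum_le_sum fun x _ => min_le_min le_rfl
            (Finset.card_le_card (Finset.filter_subset_filter _ fun a ha => ?_))) _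
          simp only [Finset.mem_sdiff, mem_slice] at ha
          simp only [Finset.mem_image, Finset.mem_sdiff, Finset.mem_product]
          exact ⟨(i, a), ⟨⟨Finset.mem_univ _, ha.1⟩, ha.2⟩, rfl⟩
      have := Finset.sum_le_sum fun i (_ : i ∈ Finset.univ) => key i
      simp only [Finset.sum_add_distrib, ← Finset.mul_sum, Finset.sum_const, Finset.card_univ,
        Fintype.card_fin, smul_eq_mul, ← mul_add] at this
      exact le_of_mul_le_mul_left this hN)
  have hcs : ∑ i, (slice I i).card = N * ρ := by
    have := sum_card_filter_slice I (fun _ => True)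
    simpa [hcard] using this
  have hr : ∀ i, r (slice I i) = ρ := by
    have := (Finset.sum_eq_sum_iff_of_le fun i (_ : i ∈ Finset.univ) => hρ (slice I i)).1
      (by simpa using h₁)
    exact fun i => this i (Finset.mem_univ i)
  have hc : ∀ i, ρ = (slice I i).card := by
    have := (Finset.sum_eq_sum_iff_of_le (f := fun _ : Fin N => ρ)
      fun i (_ : i ∈ Finset.univ) => hr i ▸ h.le_card (slice I i)).1
      (by simpa using hcs.symm)
    exact fun i => this i (Finset.mem_univ i)
  -- The second rank of `I` equals its size, so every inequality between them is tight: the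
  -- projection is injective, which makes the slices disjoint, and no colour exceeds its bound.
  have himage : (I.image Prod.snd).card = ∑ x, ((I.image Prod.snd).filter fun a => c a = x).card :=
    Finset.card_eq_sum_card_fiberwise (by simp)
  have hmin : ∑ x, min (b x) ((I.image Prod.snd).filter fun a => c a = x).card ≤
      ∑ x, ((I.image Prod.snd).filter fun a => c a = x).card :=
    Finset.sum_le_sum fun x _ => min_le_right _ _
  have hle := Finset.card_image_le (s := I) (f := Prod.snd)
  have hinj : Set.InjOn Prod.snd (I : Set (Fin N × α)) := Finset.card_image_iff.1 (by omega)
  have hb : ∀ x, min (b x) ((I.image Prod.snd).filter fun a => c a = x).card =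
      ((I.image Prod.snd).filter fun a => c a = x).card := by
    have := (Finset.sum_eq_sum_iff_of_le fun x (_ : x ∈ Finset.univ) =>
      min_le_right (b x) ((I.image Prod.snd).filter fun a => c a = x).card).1 (by omega)
    exact fun x => this x (Finset.mem_univ x)
  refine ⟨slice I, fun i a ha => ?_, fun i j hij => ?_, fun i => ⟨(hc i).symm, hr i⟩, fun x => ?_⟩
  · simpa using hI (mem_slice.1 ha)
  · refine Finset.disjoint_left.2 fun a hi hj => hij ?_
    exact congrArg Prod.fst (hinj (mem_slice.1 hi) (mem_slice.1 hj) rfl)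
  · have hx : (I.filter fun p => c p.2 = x).image Prod.snd ⊆
        (I.image Prod.snd).filter fun a => c a = x := by
      intro a
      simp +contextual
    rw [sum_card_filter_slice, ← Finset.card_image_of_injOn (f := Prod.snd)
      (hinj.mono fun p hp => (Finset.mem_filter.1 hp).1)]
    exact (Finset.card_le_card hx).trans (min_eq_right_iff.1 (hb x))

end IsRankFunction

/-! ### The graphic matroid and orientations of forests -/

namespace SimpleGraph

variable {V : Type*}

/-- The functions on the vertices that are constant along the given edges. -/
def constantAlong (A : Set (Sym2 V)) : Submodule ℚ (V → ℚ) where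
  carrier := {f | ∀ u v, s(u, v) ∈ A → f u = f v}
  add_mem' hf hg u v h := by simp [hf u v h, hg u v h]
  zero_mem' _ _ _ := rfl
  smul_mem' a f hf u v h := by simp [hf u v h]

theorem mem_constantAlong {A : Set (Sym2 V)} {f : V → ℚ} :
    f ∈ constantAlong A ↔ ∀ u v, s(u, v) ∈ A → f u = f v := Iff.rfl

theorem constantAlong_anti {A B : Set (Sym2 V)} (h : A ⊆ B) :
    constantAlong B ≤ constantAlong A := fun _ hf u v huv => hf u v (h huv)

/-- Functions constant along `A` are exactly the pullbacks of functions on the components. -/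
theorem finrank_constantAlong [Finite V] (A : Set (Sym2 V)) :
    Module.finrank ℚ (constantAlong A) = Nat.card (fromEdgeSet A).ConnectedComponent := by
  classical
  have := Fintype.ofFinite V
  have := Fintype.ofFinite (fromEdgeSet A).ConnectedComponent
  have hinj : Function.Injective (LinearMap.funLeft ℚ ℚ (fromEdgeSet A).connectedComponentMk) :=
    LinearMap.funLeft_injective_of_surjective _ _ _ Quot.mk_surjective
  have hrange : LinearMap.range (LinearMap.funLeft ℚ ℚ (fromEdgeSet A).connectedComponentMk) =
      constantAlong A := by
    ext f
    constructor
    · rintro ⟨g, rfl⟩ u v huv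
      by_cases h : u = v
      · rw [h]
      · have : (fromEdgeSet A).connectedComponentMk u = (fromEdgeSet A).connectedComponentMk v :=
          ConnectedComponent.sound (Adj.reachable ((fromEdgeSet_adj A).2 ⟨huv, h⟩))
        simp [LinearMap.funLeft_apply, this]
    · intro hf
      have hwalk : ∀ (v w : V) (p : (fromEdgeSet A).Walk v w), f v = f w := by
        intro v w p
        induction p with
        | nil => rfl
        | cons h _ ih => exact (hf _ _ ((fromEdgeSet_adj A).1 h).1).trans ih
      exact ⟨ConnectedComponent.lift f fun v w p _ => hwalk v w p,
        by ext; simp [LinearMap.funLeft_apply]⟩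
  rw [← hrange, LinearMap.finrank_range_of_inj hinj, Module.finrank_fintype_fun_eq_card,
    Nat.card_eq_fintype_card]

variable [Fintype V]

/-- The rank function of the graphic matroid of the complete graph. -/
noncomputable def graphicRank (A : Finset (Sym2 V)) : ℕ :=
  Fintype.card V - Module.finrank ℚ (constantAlong (A : Set (Sym2 V)))

theorem finrank_constantAlong_le (A : Set (Sym2 V)) :
    Module.finrank ℚ (constantAlong A) ≤ Fintype.card V := by
  simpa using Submodule.finrank_le (constantAlong A)

theorem graphicRank_add_card (A : Finset (Sym2 V)) :
    graphicRank A + Nat.card (fromEdgeSet (A : Set (Sym2 V))).ConnectedComponent =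
      Fintype.card V := by
  have := finrank_constantAlong_le (A : Set (Sym2 V))
  rw [graphicRank, ← finrank_constantAlong]
  omega

/-- The rank is the codimension of `constantAlong A`. A new edge imposes one linear equation, and
submodularity is the dimension formula for the sum and the intersection of two subspaces. -/
theorem isRankFunction_graphicRank [DecidableEq V] :
    IsRankFunction (graphicRank (V := V)) := by
  refine ⟨?_, fun A B h => ?_, fun e A => ?_, fun A B => ?_⟩
  · have : constantAlong (∅ : Set (Sym2 V)) = ⊤ := by
      ext; simp [mem_constantAlong]
    rw [graphicRank, Finset.coe_empty, this]
    simp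
  · exact Nat.sub_le_sub_left
      (Submodule.finrank_mono (constantAlong_anti (Finset.coe_subset.2 h))) _
  · induction e with | _ u v
    let φ : (V → ℚ) →ₗ[ℚ] ℚ :=
      LinearMap.proj (R := ℚ) (φ := fun _ : V => ℚ) u - LinearMap.proj v
    have h1 : constantAlong (A : Set (Sym2 V)) ⊓ LinearMap.ker φ ≤
        constantAlong ((insert s(u, v) A : Finset (Sym2 V)) : Set (Sym2 V)) := by
      rintro f ⟨hf, hφ⟩ x y hxy
      have huv : f u = f v := sub_eq_zero.1 hφ
      simp only [Finset.coe_insert, Set.mem_insert_iff, Sym2.eq_iff] at hxy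
      rcases hxy with (⟨rfl, rfl⟩ | ⟨rfl, rfl⟩) | h
      · exact huv
      · exact huv.symm
      · exact hf x y h
    have h2 := Submodule.finrank_mono h1
    have h3 := Submodule.finrank_sup_add_finrank_inf_eq (constantAlong (A : Set (Sym2 V)))
      (LinearMap.ker φ)
    have h4 := Submodule.finrank_le (constantAlong (A : Set (Sym2 V)) ⊔ LinearMap.ker φ)
    have h5 := LinearMap.finrank_range_add_finrank_ker φ
    have h6 := Submodule.finrank_le (LinearMap.range φ)
    rw [Module.finrank_fintype_fun_eq_card] at h4 h5
    rw [Module.finrank_self] at h6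
    unfold graphicRank
    omega
  · have h1 := Submodule.finrank_sup_add_finrank_inf_eq (constantAlong (A : Set (Sym2 V)))
      (constantAlong (B : Set (Sym2 V)))
    have h2 : constantAlong (A : Set (Sym2 V)) ⊔ constantAlong (B : Set (Sym2 V)) ≤
        constantAlong ((A ∩ B : Finset (Sym2 V)) : Set (Sym2 V)) :=
      sup_le (constantAlong_anti (by simp)) (constantAlong_anti (by simp))
    have h3 : constantAlong (A : Set (Sym2 V)) ⊓ constantAlong (B : Set (Sym2 V)) ≤
        constantAlong ((A ∪ B : Finset (Sym2 V)) : Set (Sym2 V)) := by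
      rintro f ⟨hA, hB⟩ u v h
      rw [Finset.coe_union] at h
      exact h.elim (hA u v) (hB u v)
    have h2 := Submodule.finrank_mono h2
    have h3 := Submodule.finrank_mono h3
    have h4 := finrank_constantAlong_le (A : Set (Sym2 V))
    have h5 := finrank_constantAlong_le (B : Set (Sym2 V))
    have h6 := finrank_constantAlong_le ((A ∩ B : Finset (Sym2 V)) : Set (Sym2 V))
    have h7 := finrank_constantAlong_le ((A ∪ B : Finset (Sym2 V)) : Set (Sym2 V))
    unfold graphicRank
    omega

theorem graphicRank_le [Nonempty V] (A : Finset (Sym2 V)) :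
    graphicRank A ≤ Fintype.card V - 1 := by
  have h1 := graphicRank_add_card A
  have h2 : 0 < Nat.card (fromEdgeSet (A : Set (Sym2 V))).ConnectedComponent := Nat.card_pos
  omega

/-- The rank of an edge set is at most the number of vertices it covers. -/
theorem graphicRank_le_card_cover {A : Finset (Sym2 V)} {W : Finset V}
    (hW : ∀ e ∈ A, ∀ v ∈ e, v ∈ W) : graphicRank A ≤ W.card := by
  let φ : (V → ℚ) →ₗ[ℚ] (W → ℚ) := LinearMap.funLeft ℚ ℚ Subtype.val
  -- A function vanishing on `W` vanishes at both ends of every edge of `A`.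
  have h1 : LinearMap.ker φ ≤ constantAlong (A : Set (Sym2 V)) := by
    intro f hf u v h
    have hz : ∀ w ∈ W, f w = 0 := fun w hw => congrFun hf ⟨w, hw⟩
    rw [hz u (hW _ h u (by simp)), hz v (hW _ h v (by simp))]
  have h2 := Submodule.finrank_mono h1
  have h3 := LinearMap.finrank_range_add_finrank_ker φ
  have h4 := Submodule.finrank_le (LinearMap.range φ)
  rw [Module.finrank_fintype_fun_eq_card] at h3 h4
  rw [Fintype.card_coe] at h4
  unfold graphicRank
  omega

theorem isTree_fromEdgeSet_of_graphicRank [DecidableEq V] [Nonempty V] {A : Finset (Sym2 V)}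
    (hdiag : ∀ e ∈ A, ¬ e.IsDiag) (hcard : A.card = Fintype.card V - 1)
    (hrank : graphicRank A = Fintype.card V - 1) : (fromEdgeSet (A : Set (Sym2 V))).IsTree := by
  have hV : 0 < Fintype.card V := Fintype.card_pos
  have hE : (fromEdgeSet (A : Set (Sym2 V))).edgeSet = A := by
    rw [edgeSet_fromEdgeSet]
    ext e
    simpa using hdiag e
  rw [isTree_iff_connected_and_card, hE]
  constructor
  · have h := graphicRank_add_card A
    have h1 : Nat.card (fromEdgeSet (A : Set (Sym2 V))).ConnectedComponent = 1 := by omega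
    have := (Nat.card_eq_one_iff_unique.1 h1).1
    exact ⟨fun u v => ConnectedComponent.exact (Subsingleton.elim _ _)⟩
  · simp [hcard]
    omega

/-- The edges of a forest have a system of distinct representatives. -/
theorem exists_injOn_head [DecidableEq V] {A : Finset (Sym2 V)} (hA : graphicRank A = A.card) :
    ∃ f : Sym2 V → V, (∀ e ∈ A, f e ∈ e) ∧ Set.InjOn f (A : Set (Sym2 V)) := by
  -- Hall's condition: a set of forest edges has size equal to its rank, hence at most the number of
  -- vertices covered.
  have hall := (Finset.all_card_le_biUnion_card_iff_exists_injective
    (fun e : A => (e : Sym2 V).toFinset)).1 (by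
      intro s
      have hs : s.map (Function.Embedding.subtype _) ⊆ A := by
        intro e he
        obtain ⟨x, -, rfl⟩ := Finset.mem_map.1 he
        exact x.2
      rw [← Finset.card_map (Function.Embedding.subtype _),
        ← isRankFunction_graphicRank.eq_card_of_subset hs hA]
      refine graphicRank_le_card_cover fun e he v hv => ?_
      obtain ⟨x, hx, rfl⟩ := Finset.mem_map.1 he
      exact Finset.mem_biUnion.2 ⟨x, hx, Sym2.mem_toFinset.2 hv⟩)
  obtain ⟨f, hf, hmem⟩ := hall
  refine ⟨fun e => if h : e ∈ A then f ⟨e, h⟩ else e.out.1, fun e he => ?_, fun e he e' he' h => ?_⟩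
  · simpa [he] using hmem ⟨e, he⟩
  · have he : e ∈ A := he
    have he' : e' ∈ A := he'
    simp only [he, he', dite_true] at h
    exact congrArg Subtype.val (hf h)

/-- A union of `k` forests has an orientation with all in-degrees at most `k`; here `c` maps an edge
to its tail. -/
theorem exists_orientation [DecidableEq V] {k : ℕ} (F : Fin k → Finset (Sym2 V))
    (hF : ∀ i, graphicRank (F i) = (F i).card) :
    ∃ c : Sym2 V → V, (∀ e ∈ Finset.univ.biUnion F, c e ∈ e) ∧
      ∀ v, ((Finset.univ.biUnion F).filter fun e => v ∈ e ∧ c e ≠ v).card ≤ k := by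
  choose f hf hinj using fun i => exists_injOn_head (hF i)
  -- The tail is the end other than the representative chosen by a forest containing `e`.
  have hc : ∀ e : Sym2 V, ∃ w, e ∈ Finset.univ.biUnion F →
      w ∈ e ∧ ∃ i, e ∈ F i ∧ ∀ v ∈ e, w ≠ v → f i e = v := by
    intro e
    by_cases he : e ∈ Finset.univ.biUnion F
    · obtain ⟨i, -, hi⟩ := Finset.mem_biUnion.1 he
      obtain ⟨w, hw⟩ := hf i e hi
      refine ⟨w, fun _ => ⟨by rw [hw]; simp, i, hi, fun v hv hne => ?_⟩⟩
      rw [hw, Sym2.mem_iff] at hv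
      exact (hv.resolve_right hne.symm).symm
    · exact ⟨e.out.1, fun h => absurd h he⟩
  choose c hc using hc
  refine ⟨c, fun e he => (hc e he).1, fun v => ?_⟩
  have hsub : ((Finset.univ.biUnion F).filter fun e => v ∈ e ∧ c e ≠ v) ⊆
      Finset.univ.biUnion fun i => (F i).filter fun e => f i e = v := by
    intro e he
    obtain ⟨he, hv, hne⟩ := Finset.mem_filter.1 he
    obtain ⟨-, i, hi, h⟩ := hc e he
    exact Finset.mem_biUnion.2 ⟨i, Finset.mem_univ i, Finset.mem_filter.2 ⟨hi, h v hv hne⟩⟩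
  refine (Finset.card_le_card hsub).trans ((Finset.card_biUnion_le_card_mul _ _ 1 ?_).trans ?_)
  · intro i _
    refine Finset.card_le_one.2 fun a ha b hb => ?_
    rw [Finset.mem_filter] at ha hb
    exact hinj i ha.1 hb.1 (ha.2.trans hb.2.symm)
  · simp

end SimpleGraph

/-! ### Spanning trees in highly edge-connected graphs -/

namespace SimpleGraph

variable {V : Type*}

open Classical in
/-- In a `2k`-edge-connected graph at least `k * (p - 1)` edges join different components when `p`
is the number of components of a subgraph. -/
theorem IsEdgeConnected.mul_le_mul_graphicRank_add [Fintype V] [Nonempty V] {G : SimpleGraph V}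
    {k : ℕ} (hG : G.IsEdgeConnected (2 * k)) (A : Finset (Sym2 V)) :
    k * (Fintype.card V - 1) ≤ k * graphicRank A + (G.edgeFinset \ A).card := by
  set H := fromEdgeSet (A : Set (Sym2 V))
  have hrank : graphicRank A + Fintype.card H.ConnectedComponent = Fintype.card V := by
    rw [← Nat.card_eq_fintype_card]
    exact graphicRank_add_card A
  rcases Nat.lt_or_ge 1 (Fintype.card H.ConnectedComponent) with hp | hp
  swap
  · exact (Nat.mul_le_mul_left k (by omega)).trans (Nat.le_add_right _ _)
  -- Double counting: at least `2k` edges leave each component, and each edge leaves at most two.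
  let leaves : H.ConnectedComponent → Sym2 V → Prop := fun C e =>
    (∃ u ∈ e, H.connectedComponentMk u = C) ∧ ∃ v ∈ e, H.connectedComponentMk v ≠ C
  have hlow : ∀ C ∈ (Finset.univ : Finset H.ConnectedComponent),
      2 * k ≤ ((G.edgeFinset \ A).bipartiteAbove leaves C).card := by
    intro C _
    by_contra! hlt
    obtain ⟨u, rfl⟩ := C.exists_rep
    obtain ⟨D, hD⟩ := Fintype.exists_ne_of_one_lt_card hp (H.connectedComponentMk u)
    obtain ⟨v, rfl⟩ := D.exists_rep
    have hreach := hG u v (s := ((G.edgeFinset \ A).bipartiteAbove leaves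
      (H.connectedComponentMk u) : Finset (Sym2 V))) (by
        rw [Set.encard_coe_eq_coe_finsetCard]
        exact_mod_cast hlt)
    obtain ⟨p⟩ := hreach
    have hstay : ∀ (x y : V) (_ : (G.deleteEdges (((G.edgeFinset \ A).bipartiteAbove leaves
        (H.connectedComponentMk u) : Finset (Sym2 V)) : Set (Sym2 V))).Walk x y),
        H.connectedComponentMk x = H.connectedComponentMk u →
        H.connectedComponentMk y = H.connectedComponentMk u := by
      intro x y p
      induction p with
      | nil => exact id
      | @cons x y z h _ ih =>
        intro hx
        refine ih ?_
        by_contra hy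
        rw [deleteEdges_adj] at h
        refine h.2 ?_
        simp only [Finset.mem_coe, Finset.mem_bipartiteAbove, Finset.mem_sdiff, mem_edgeFinset,
          mem_edgeSet]
        refine ⟨⟨h.1, fun hA => hy ?_⟩, ⟨x, by simp, hx⟩, y, by simp, hy⟩
        rw [← hx]
        exact (ConnectedComponent.sound
          (Adj.reachable ((fromEdgeSet_adj _).2 ⟨hA, h.1.ne⟩))).symm
    exact hD (hstay u v p rfl)
  have hup : ∀ e ∈ G.edgeFinset \ A,
      ((Finset.univ : Finset H.ConnectedComponent).bipartiteBelow leaves e).card ≤ 2 := by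
    intro e _
    induction e with | _ u v
    have hsub : (Finset.univ : Finset H.ConnectedComponent).bipartiteBelow leaves s(u, v) ⊆
        {H.connectedComponentMk u, H.connectedComponentMk v} := by
      intro C hC
      obtain ⟨-, ⟨w, hw, rfl⟩, -⟩ := Finset.mem_bipartiteBelow _ |>.1 hC
      rcases Sym2.mem_iff.1 hw with rfl | rfl <;> simp
    exact (Finset.card_le_card hsub).trans Finset.card_le_two
  have hcount := Finset.card_mul_le_card_mul leaves hlow hup
  rw [Finset.card_univ] at hcount
  have hp' : k * (Fintype.card V - 1) ≤
      k * (graphicRank A + Fintype.card H.ConnectedComponent) :=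
    Nat.mul_le_mul_left k (by omega)
  rw [mul_add] at hp'
  nlinarith

open Classical in
/-- In a `2k`-edge-connected graph, `N ≤ k` disjoint spanning trees can be chosen such that they
contain little more than an `N / k` fraction of the edges at each vertex. -/
theorem IsEdgeConnected.exists_spanning_trees [Fintype V] [Nonempty V] {G : SimpleGraph V}
    {k N : ℕ} (hk : 0 < k) (hN : N ≤ k) (hG : G.IsEdgeConnected (2 * k)) :
    ∃ T : Fin N → SimpleGraph V, (∀ i, T i ≤ G ∧ (T i).IsTree) ∧
      (∀ i j, i ≠ j → Disjoint (T i).edgeSet (T j).edgeSet) ∧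
      ∀ v, ∑ i, (T i).degree v ≤ N * G.degree v / k + 1 + k := by
  -- A single colour with bound `|E(G)|` imposes no restriction.
  obtain ⟨F, hFE, hFd, hFb, -⟩ := isRankFunction_graphicRank.exists_disjoint_bases G.edgeFinset
    (fun _ => ()) (fun _ => G.edgeFinset.card) k (Fintype.card V - 1) graphicRank_le (by
      intro A _
      have := hG.mul_le_mul_graphicRank_add A
      simpa [Finset.card_le_card Finset.sdiff_subset] using this)
  obtain ⟨c, hc, hin⟩ := exists_orientation F fun i => (hFb i).2.trans (hFb i).1.symm
  set E := Finset.univ.biUnion F with hE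
  have hEG : E ⊆ G.edgeFinset := Finset.biUnion_subset.2 fun i _ => hFE i
  have hout : ∀ v, (E.filter fun e => c e = v).card ≤ G.degree v := by
    intro v
    rw [← card_incidenceFinset_eq_degree, incidenceFinset_eq_filter]
    refine Finset.card_le_card fun e he => ?_
    obtain ⟨heE, rfl⟩ := Finset.mem_filter.1 he
    exact Finset.mem_filter.2 ⟨hEG heE, hc e heE⟩
  -- Each of the `k` disjoint bases has at least `|V| - 1 - r(A)` elements outside `A`.
  have hrank : ∀ A, k * (Fintype.card V - 1) ≤ k * graphicRank A + (E \ A).card := by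
    intro A
    have h1 : ∀ i, Fintype.card V - 1 ≤ graphicRank A + (F i \ A).card := fun i => by
      have h2 := isRankFunction_graphicRank.union_le A (F i \ A)
      have h3 := isRankFunction_graphicRank.mono (F i) (A ∪ (F i \ A)) (by
        rw [Finset.union_sdiff_self_eq_union]
        exact Finset.subset_union_right)
      rw [(hFb i).2] at h3
      exact h3.trans h2
    have h2 := Finset.sum_le_sum fun i (_ : i ∈ Finset.univ) => h1 i
    simp only [Finset.sum_const, Finset.card_univ, Fintype.card_fin, smul_eq_mul,
      Finset.sum_add_distrib] at h2
    refine h2.trans (Nat.add_le_add_left ?_ _)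
    rw [← Finset.card_biUnion fun i _ j _ hij =>
      (hFd i j hij).mono Finset.sdiff_subset Finset.sdiff_subset]
    refine Finset.card_le_card (Finset.biUnion_subset.2 fun i hi => ?_)
    exact Finset.sdiff_subset_sdiff (Finset.subset_biUnion_of_mem F hi) le_rfl
  obtain ⟨T, hTE, hTd, hTb, hTc⟩ := isRankFunction_graphicRank.exists_disjoint_bases E c
    (fun v => N * G.degree v / k + 1) N (Fintype.card V - 1) graphicRank_le (by
      intro A _
      refine le_of_mul_le_mul_left ?_ hk
      -- Colour by colour: if the cap is the minimum, out-degree at most `deg v` suffices, the `+ 1`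
      -- making up for the floor; otherwise `N ≤ k` does.
      have h1 : N * (E \ A).card ≤
          k * ∑ v, min (N * G.degree v / k + 1) ((E \ A).filter fun e => c e = v).card := by
        rw [Finset.card_eq_sum_card_fiberwise (f := c) (t := Finset.univ) (by simp),
          Finset.mul_sum, Finset.mul_sum]
        refine Finset.sum_le_sum fun v _ => ?_
        have h2 : ((E \ A).filter fun e => c e = v).card ≤ G.degree v :=
          (Finset.card_le_card (Finset.filter_subset_filter _ Finset.sdiff_subset)).trans (hout v)
        rcases min_choice (N * G.degree v / k + 1) ((E \ A).filter fun e => c e = v).card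
          with h | h <;> rw [h]
        · exact (Nat.mul_le_mul_left N h2).trans (Nat.lt_mul_div_succ _ hk).le
        · exact Nat.mul_le_mul_right _ hN
      have h2 := Nat.mul_le_mul_left N (hrank A)
      rw [mul_add] at h2 ⊢
      calc _ = N * (k * (Fintype.card V - 1)) := by ring
        _ ≤ _ := h2
        _ ≤ _ := Nat.add_le_add (by rw [mul_left_comm]) h1)
  have hdiag : ∀ i, ∀ e ∈ T i, ¬ e.IsDiag := fun i e he =>
    G.not_isDiag_of_mem_edgeSet (mem_edgeFinset.1 (hEG (hTE i he)))
  have hedge : ∀ i, (fromEdgeSet (T i : Set (Sym2 V))).edgeSet = T i := by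
    intro i
    rw [edgeSet_fromEdgeSet]
    ext e
    simpa using hdiag i e
  refine ⟨fun i => fromEdgeSet (T i), fun i => ⟨?_, ?_⟩, fun i j hij => ?_, fun v => ?_⟩
  · rw [← edgeSet_subset_edgeSet, hedge]
    exact fun e he => mem_edgeFinset.1 (hEG (hTE i he))
  · exact isTree_fromEdgeSet_of_graphicRank (hdiag i) (hTb i).1 (hTb i).2
  · rw [hedge, hedge]
    exact Finset.disjoint_coe.2 (hTd i j hij)
  · have h1 : ∀ (i : Fin N) (_ : Fintype ((fromEdgeSet (T i : Set (Sym2 V))).neighborSet v)),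
        (fromEdgeSet (T i : Set (Sym2 V))).degree v ≤
        ((T i).filter fun e => c e = v).card +
          ((T i).filter fun e => v ∈ e ∧ c e ≠ v).card := by
      intro i _
      rw [← card_incidenceFinset_eq_degree, incidenceFinset_eq_filter]
      refine (Finset.card_le_card fun e he => ?_).trans (Finset.card_union_le _ _)
      rw [Finset.mem_filter, mem_edgeFinset, hedge] at he
      by_cases h : c e = v
      · exact Finset.mem_union_left _ (Finset.mem_filter.2 ⟨he.1, h⟩)
      · exact Finset.mem_union_right _ (Finset.mem_filter.2 ⟨he.1, he.2, h⟩)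
    refine le_trans (Finset.sum_le_sum fun i _ => h1 i _) ?_
    rw [Finset.sum_add_distrib]
    refine Nat.add_le_add (hTc v) (le_trans ?_ (hin v))
    rw [← Finset.card_biUnion fun i _ j _ hij =>
      (hTd i j hij).mono (Finset.filter_subset _ _) (Finset.filter_subset _ _)]
    exact Finset.card_le_card (Finset.biUnion_subset.2 fun i _ =>
      Finset.filter_subset_filter _ (hTE i))

end SimpleGraph

/-! ### Choice of constants -/

open Classical in
theorem mainTheorem7 (ε : ℝ) (hε : 0 < ε) (hε4 : ε < 4) (m : ℕ) :
    ∃ L : ℕ, ∀ n : ℕ, (n : ℤ) = 2 + (m : ℤ) + ⌈Real.logb 2 (1 / ε)⌉ →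
      ∀ (V : Type*) (S : Type*) [Fintype V] [Fintype S] [Nonempty V] (G : StubGraph V S),
        G.IsEdgeConnected (2 ^ n) → (∀ v : V, L ≤ G.degree v) →
          ∃ T : Fin (2 ^ m) → SimpleGraph V,
            (∀ i, G.IsSpanningTree (T i)) ∧
            (∀ i j, i ≠ j → Disjoint (T i).edgeSet (T j).edgeSet) ∧
            ∀ v : V, ((∑ i, (T i).degree v : ℕ) : ℝ) ≤ ε * (G.degree v : ℝ) := by
  set z := ⌈Real.logb 2 (1 / ε)⌉
  -- Here `ε < 4` enters: it makes `j = 1 + z` a natural number.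
  have hz2 : -1 ≤ z := by
    have h : -2 < Real.logb 2 (1 / ε) := by
      rw [Real.lt_logb_iff_rpow_lt (by norm_num) (by positivity), lt_div_iff₀ hε]
      norm_num
      linarith
    have := Int.lt_ceil.2 (show ((-2 : ℤ) : ℝ) < Real.logb 2 (1 / ε) by exact_mod_cast h)
    omega
  obtain ⟨j, hj⟩ : ∃ j : ℕ, (j : ℤ) = 1 + z := ⟨(1 + z).toNat, Int.toNat_of_nonneg (by omega)⟩
  have hpow : 2 ≤ ε * 2 ^ j := by
    have h1 : Real.logb 2 (1 / ε) ≤ (j : ℝ) - 1 := by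
      have : (z : ℝ) = (j : ℝ) - 1 := by
        have : (j : ℝ) = 1 + z := by exact_mod_cast hj
        linarith
      rw [← this]
      exact Int.le_ceil _
    rw [Real.logb_le_iff_le_rpow (by norm_num) (by positivity), Real.rpow_sub (by norm_num),
      Real.rpow_natCast, Real.rpow_one, div_le_iff₀ hε] at h1
    linarith
  -- Half of `ε * deg v` pays for the proportional term, and `L` lets the other half pay for `1 +
  -- k`.
  obtain ⟨L, hL⟩ := exists_nat_ge (2 * (1 + 2 ^ (m + j)) / ε)
  refine ⟨L, fun n hn V S _ _ _ G hG hdeg => ?_⟩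
  obtain rfl : n = m + j + 1 := by omega
  have hG' : G.minus.IsEdgeConnected (2 * 2 ^ (m + j)) := by
    rw [← pow_succ']
    exact hG
  obtain ⟨T, hT, hd, hb⟩ := hG'.exists_spanning_trees (N := 2 ^ m) (by positivity)
    (Nat.pow_le_pow_right (by norm_num) (by omega))
  refine ⟨T, fun i => ⟨(hT i).1, (hT i).2⟩, hd, fun v => ?_⟩
  have h1 : 2 ^ m * G.minus.degree v / 2 ^ (m + j) = G.minus.degree v / 2 ^ j := by
    rw [pow_add]
    exact Nat.mul_div_mul_left _ _ (by positivity)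
  have h2 : ((∑ i, (T i).degree v : ℕ) : ℝ) ≤ (G.minus.degree v : ℝ) / 2 ^ j + 1 + 2 ^ (m + j) := by
    have h3 : ((∑ i, (T i).degree v : ℕ) : ℝ) ≤
        ((G.minus.degree v / 2 ^ j + 1 + 2 ^ (m + j) : ℕ) : ℝ) :=
      Nat.cast_le.2 (h1 ▸ hb v)
    have h4 : ((G.minus.degree v / 2 ^ j : ℕ) : ℝ) ≤ (G.minus.degree v : ℝ) / 2 ^ j := by
      simpa using Nat.cast_div_le (α := ℝ) (m := G.minus.degree v) (n := 2 ^ j)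
    push_cast at h3 ⊢
    linarith
  have h3 : (G.minus.degree v : ℝ) ≤ G.degree v := by
    rw [StubGraph.degree]
    exact_mod_cast Nat.le_add_right _ _
  have h4 : (G.minus.degree v : ℝ) / 2 ^ j ≤ ε / 2 * G.degree v := by
    rw [div_le_iff₀ (by positivity)]
    have h5 : (0 : ℝ) ≤ G.degree v := by positivity
    nlinarith
  have h5 : 1 + (2 : ℝ) ^ (m + j) ≤ ε / 2 * G.degree v := by
    have h6 : (L : ℝ) ≤ G.degree v := by exact_mod_cast hdeg v
    have h7 := hL.trans h6
    rw [div_le_iff₀ hε] at h7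
    linarith
  linarith
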